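/- Let $\mathcal A$ be a finite set, let $\Omega=\mathcal A^{\mathbb N}$, $\mathbb N=\{1,2,\dots\}$, carry the product topology and its Borel $\sigma$-algebra, and let $\varphi:\Omega\to\Omega$, $\varphi(\omega)_j=\omega_{j+1}$, be the left shift. Let $\mathbb P$ be a $\varphi$-invariant Borel probability measure on $\Omega$, and for a finite word $w$ over $\mathcal A$, of length $|w|$, let $\mathbb P(w)$ denote the $\mathbb P$-measure of the set of all $\omega\in\Omega$ that begin with $w$. Assume that $\mathbb P$ satisfies the following condition. **(SLD)** There are sequences $(\tau_t)_{t\in\mathbb N}\subset\{0,1,2,\dots\}$ and $(c_t)_{t\in\mathbb N}\subset[0,\infty)$ with $\tau_t/t\to0$ and $c_t/t\to0$ such that for all $t\in\mathbb N$, every word $u$ of length $t$ and every finite word $v$ with $|v|\ge1$, there is a finite (possibly empty) word $\xi$ with $|\xi|\le\tau_t$ and $$\mathbb P(u\xi v)\ \ge\ e^{-c_t}\,\mathbb P(u)\,\mathbb P(v).$$ Endow $\mathbb R^d$ with the Euclidean inner product $(\cdot,\cdot)$ and norm $|\cdot|$. Let $f\in C(\Omega,\mathbb R^d)$, $\|f\|=\sup_{\omega\in\Omega}|f(\omega)|$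 and $S_tf=\sum_{s=0}^{t-1}f\circ\varphi^s$. Then: 1. For all $\alpha\in\mathbb R^d$ the limit $$q_f(\alpha):=\lim_{t\to\infty}\frac1t\log\int_\Omega e^{(\alpha,S_tf)}\,d\mathbb P$$ exists and is finite, and the map $\alpha\mapsto q_f(\alpha)$ is convex and $\|f\|$-Lipschitz. 2. There is a good convex rate function $I_f:\mathbb R^d\to[0,\infty]$ (that is, $I_f$ is convex and lower semicontinuous, and its level sets $\{I_f\le a\}$, $a\in\mathbb R$, are compact) such that for every open set $O\subset\mathbb R^d$ and every closed set $\Gamma\subset\mathbb R^d$, $$\liminf_{t\to\infty}\frac1t\log\mathbb P\Big(\frac1tS_tf\in O\Big)\ge-\inf_{x\in O}I_f(x),\qquad \limsup_{t\to\infty}\frac1t\log\mathbb P\Big(\frac1tS_tf\in\Gamma\Big)\le-\inf_{x\in\Gamma}I_f(x),$$ with the conventions $\log0=-\infty$ and $\inf_\emptyset=+\infty$. Moreover, $I_f$ is the Fenchel–Legendre transform of $q_f$: $$I_f(x)=q_f^*(x)=\sup_{\alpha\in\mathbb R^d}\big((\alpha,x)-q_f(\alpha)\big),\qquad x\in\mathbb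 R^d.$$ -/

import Mathlib

namespace ShiftLDP

open MeasureTheory Filter Topology

/-- The left shift on one-sided sequences. Sequences are indexed from `0`. -/
def shift {A : Type*} (ω : ℕ → A) : ℕ → A := fun j => ω (j + 1)

/-- The cylinder set of a finite word `w`: the sequences that start with `w`.
The cylinder of the empty word is the whole space. -/
def wordCylinder {A : Type*} (w : List A) : Set (ℕ → A) :=
  {ω | ∀ i : Fin w.length, ω i = w.get i}

/-- Selective lower decoupling, including the standing requirements
`c t ≥ 0`, `c t = o(t)` and `τ t = o(t)`. Words are lists, `++` is concatenation. -/
def SelectiveLowerDecoupling {A : Type*} [MeasurableSpace A] (P : Measure (ℕ → A)) : Prop :=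
  ∃ (τ : ℕ → ℕ) (c : ℕ → ℝ),
    (∀ t, 1 ≤ t → 0 ≤ c t) ∧
    Tendsto (fun t : ℕ => c t / (t : ℝ)) atTop (𝓝 0) ∧
    Tendsto (fun t : ℕ => (τ t : ℝ) / (t : ℝ)) atTop (𝓝 0) ∧
    ∀ t : ℕ, 1 ≤ t → ∀ u v : List A, u.length = t → 1 ≤ v.length →
      ∃ ξ : List A, ξ.length ≤ τ t ∧
        Real.exp (-c t) * P.real (wordCylinder u) * P.real (wordCylinder v)
          ≤ P.real (wordCylinder (u ++ ξ ++ v))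

/-- A rate function: lower semicontinuous with values in `[0, ∞]`. -/
def IsRateFunction {E : Type*} [TopologicalSpace E] (I : E → EReal) : Prop :=
  LowerSemicontinuous I ∧ ∀ x, 0 ≤ I x

/-- A good rate function: a rate function all of whose level sets are compact. -/
def IsGoodRateFunction {E : Type*} [TopologicalSpace E] (I : E → EReal) : Prop :=
  IsRateFunction I ∧ ∀ a : ℝ, IsCompact {x | I x ≤ (a : EReal)}

/-- Convexity of an extended-real-valued function (used for functions that never take
the value `-∞`; the convention `0 * ∞ = 0` is harmless in the inequality). -/
def IsConvexFunction {E : Type*} [AddCommGroup E] [Module ℝ E] (I : E → EReal) : Prop :=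
  ∀ x y : E, ∀ a b : ℝ, 0 ≤ a → 0 ≤ b → a + b = 1 →
    I (a • x + b • y) ≤ (a : EReal) * I x + (b : EReal) * I y

/-- The large deviation principle at speed `t` for the sequence `Z t` under `P`, with rate
function `I`. Here `ENNReal.log` is the extended logarithm, with `log 0 = -∞`. -/
def SatisfiesLDP {Ω E : Type*} [MeasurableSpace Ω] [TopologicalSpace E]
    (P : Measure Ω) (Z : ℕ → Ω → E) (I : E → EReal) : Prop :=
  (∀ O : Set E, IsOpen O →
    -(⨅ x ∈ O, I x) ≤
      liminf (fun t : ℕ => ((1 / (t : ℝ) : ℝ) : EReal) * ENNReal.log (P {ω | Z t ω ∈ O})) atTop) ∧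
  (∀ Γ : Set E, IsClosed Γ →
    limsup (fun t : ℕ => ((1 / (t : ℝ) : ℝ) : EReal) * ENNReal.log (P {ω | Z t ω ∈ Γ})) atTop
      ≤ -(⨅ x ∈ Γ, I x))

/-- The Fenchel–Legendre transform `x ↦ sup_α ((α, x) - q α)`, with values in `(-∞, ∞]`. -/
noncomputable def legendreTransform {E : Type*} [NormedAddCommGroup E] [InnerProductSpace ℝ E]
    (q : E → ℝ) (x : E) : EReal :=
  ⨆ α : E, ((inner ℝ α x - q α : ℝ) : EReal)

end ShiftLDP

/-!
The proof follows the Ruelle–Lanford approach. For a sequence `S t` of random vectors, let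
`asymptoticEpigraph P S` be the set of pairs `(x, a)` such that `S t / t` is close to `x` with
probability at least `exp (-t (a + o(1)))` for all large `t`. It is closed, and it turns out to be
the epigraph of the rate function. Two properties carry the argument.

* `EventualDichotomy`: if `(x, a)` is not in this set, the lower bound fails for all large `t`, so
  that the failure is an exponential upper bound on the probability of a small ball.
* The set is convex.

Both come from `DecoupledAt.eventually_expLowerBound`: lower bounds at a single time `n` yield
lower bounds at all large times, also for convex combinations. For this, `N` blocks of length `n`
are concatenated. By `DecoupledAt.exists_gap`, an event on the first `n` coordinates and an event
on finitely many coordinates occur one after the other, with a fixed gap `k ≤ τ n`, with probability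
at least `exp (-c n) / (τ n + 1)` times the product: the selective decoupling condition provides
a connecting word for each pair of words, and some length accounts for at least the average share.
The cost per block and the gaps are `o(n)`, and so is the variation of the Birkhoff sum among
sequences with the same first `n` letters.

The rest holds for any norm-bounded sequence `S t / t` with these two properties. A finite cover of
a closed ball shows that the scaled cumulant generating function converges to the conjugate
`q α = sup ((α, x) - a)` over the epigraph (`tendsto_log_integral_exp`); as a supremum of affine
functions with bounded slopes it is convex and Lipschitz. Separating a point from the closed convex
epigraph shows that the Legendre transform of `q` has exactly this epigraph
(`legendreTransform_le_iff`), and the large deviation bounds are read off from the definition of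
the epigraph and the same covering argument (`satisfiesLDP_legendreTransform`).
-/

namespace ShiftLDP

open MeasureTheory Filter Topology

/-! ### The asymptotic epigraph -/

section Abstract

variable {Ω E : Type*} [MeasurableSpace Ω] [NormedAddCommGroup E] [InnerProductSpace ℝ E]

/-- The event that `S t / t` is within `ε` of `z.1` has probability at least
`exp (-t (z.2 + ε))`. -/
def ExpLowerBound (P : Measure Ω) (S : ℕ → Ω → E) (z : E × ℝ) (ε : ℝ) (t : ℕ) : Prop :=
  Real.exp (-(t * (z.2 + ε))) ≤ P.real {ω | ‖S t ω - (t : ℝ) • z.1‖ ≤ ε * t}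

/-- The set of pairs `(x, a)` such that `S t / t` is close to `x` with probability at least
`exp (-t (a + o(1)))` for all large `t`. When a large deviation principle holds, it is the
epigraph of the rate function. -/
def asymptoticEpigraph (P : Measure Ω) (S : ℕ → Ω → E) : Set (E × ℝ) :=
  {z | ∀ ε > 0, ∀ᶠ t : ℕ in atTop, ExpLowerBound P S z ε t}

variable {P : Measure Ω} {S : ℕ → Ω → E} {z w : E × ℝ} {ε ε' R : ℝ}

lemma ExpLowerBound.of_norm_sub_add_le [IsFiniteMeasure P] {t : ℕ} (h : ExpLowerBound P S w ε t)
    (hzw : ‖w - z‖ + ε ≤ ε') : ExpLowerBound P S z ε' t := by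
  have ht : (0 : ℝ) ≤ t := t.cast_nonneg
  have h1 : ‖w.1 - z.1‖ ≤ ‖w - z‖ := norm_fst_le (w - z)
  have h2 : |w.2 - z.2| ≤ ‖w - z‖ := norm_snd_le (w - z)
  refine le_trans (Real.exp_le_exp.2 ?_) (h.trans (measureReal_mono fun ω hω => ?_))
  · have := le_abs_self (w.2 - z.2)
    have : t * (w.2 + ε) ≤ t * (z.2 + ε') := mul_le_mul_of_nonneg_left (by linarith) ht
    linarith
  · have hω' : ‖S t ω - (t : ℝ) • w.1‖ ≤ ε * t := hω
    have h3 : S t ω - (t : ℝ) • z.1 = (S t ω - (t : ℝ) • w.1) + (t : ℝ) • (w.1 - z.1) := by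
      rw [smul_sub]; abel
    change ‖S t ω - (t : ℝ) • z.1‖ ≤ ε' * t
    rw [h3]
    refine (norm_add_le _ _).trans ?_
    rw [norm_smul, Real.norm_of_nonneg ht]
    nlinarith

lemma isClosed_asymptoticEpigraph [IsFiniteMeasure P] : IsClosed (asymptoticEpigraph P S) := by
  refine isClosed_of_closure_subset fun z hz ε hε => ?_
  obtain ⟨w, hw, hzw⟩ := Metric.mem_closure_iff.1 hz (ε / 2) (by positivity)
  filter_upwards [hw (ε / 2) (by positivity)] with t ht
  refine ht.of_norm_sub_add_le ?_
  rw [dist_eq_norm, norm_sub_rev] at hzw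
  linarith

lemma snd_nonneg_of_mem_asymptoticEpigraph [IsProbabilityMeasure P]
    (hz : z ∈ asymptoticEpigraph P S) : 0 ≤ z.2 := by
  refine le_of_forall_pos_le_add fun ε hε => ?_
  obtain ⟨t, ht, ht1⟩ := ((hz ε hε).and (eventually_ge_atTop 1)).exists
  have h1 := Real.exp_le_one_iff.1 (le_trans ht measureReal_le_one)
  have : (1 : ℝ) ≤ t := by exact_mod_cast ht1
  by_contra! h
  nlinarith

lemma norm_fst_le_of_mem_asymptoticEpigraph (hS : ∀ t ω, ‖S t ω‖ ≤ t * R)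
    (hz : z ∈ asymptoticEpigraph P S) : ‖z.1‖ ≤ R := by
  refine le_of_forall_pos_le_add fun ε hε => ?_
  obtain ⟨t, ht, ht1⟩ := ((hz ε hε).and (eventually_ge_atTop 1)).exists
  have h1 : (1 : ℝ) ≤ t := by exact_mod_cast ht1
  have hne : {ω | ‖S t ω - (t : ℝ) • z.1‖ ≤ ε * t}.Nonempty := by
    by_contra hne
    rw [Set.not_nonempty_iff_eq_empty] at hne
    have := (Real.exp_pos _).trans_le ht
    simp [hne] at this
  obtain ⟨ω, hω⟩ := hne
  have h2 : ‖(t : ℝ) • z.1‖ ≤ t * R + ε * t := by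
    have := norm_sub_norm_le ((t : ℝ) • z.1) (S t ω)
    rw [norm_sub_rev] at this
    have hω' : ‖S t ω - (t : ℝ) • z.1‖ ≤ ε * t := hω
    linarith [hS t ω]
  rw [norm_smul, Real.norm_of_nonneg (by linarith)] at h2
  by_contra! h
  nlinarith

lemma mem_asymptoticEpigraph_of_le [IsFiniteMeasure P] {x : E} {a b : ℝ}
    (h : (x, a) ∈ asymptoticEpigraph P S) (hab : a ≤ b) : (x, b) ∈ asymptoticEpigraph P S := by
  intro ε hε
  filter_upwards [h ε hε] with t ht
  refine le_trans (Real.exp_le_exp.2 ?_) ht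
  have ht : (0 : ℝ) ≤ t := t.cast_nonneg
  have : t * (a + ε) ≤ t * (b + ε) := mul_le_mul_of_nonneg_left (by linarith) ht
  simpa using this

/-! ### Exponential upper bounds on compact sets -/

/-- Local exponential bounds for a sequence of measures add up to a bound on a compact set,
at the cost of a constant factor: the number of sets in a finite cover. -/
lemma exists_eventually_measureReal_le_of_isCompact {μ : ℕ → Measure Ω}
    [∀ t, IsFiniteMeasure (μ t)] {K : Set E} (hK : IsCompact K) (b : ℝ)
    (h : ∀ x ∈ K, ∃ ε > 0, ∀ᶠ t : ℕ in atTop,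
      (μ t).real {ω | ‖S t ω - (t : ℝ) • x‖ ≤ ε * t} ≤ Real.exp (t * b)) :
    ∃ N : ℝ, 1 ≤ N ∧ ∀ᶠ t : ℕ in atTop,
      (μ t).real {ω | (t : ℝ)⁻¹ • S t ω ∈ K} ≤ N * Real.exp (t * b) := by
  refine hK.induction_on (p := fun s => ∃ N : ℝ, 1 ≤ N ∧ ∀ᶠ t : ℕ in atTop,
      (μ t).real {ω | (t : ℝ)⁻¹ • S t ω ∈ s} ≤ N * Real.exp (t * b)) ?_ ?_ ?_ ?_
  · exact ⟨1, le_rfl, Eventually.of_forall fun t => by simp [Real.exp_nonneg]⟩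
  · rintro s s' hss ⟨N, hN, h⟩
    refine ⟨N, hN, h.mono fun t ht => le_trans (measureReal_mono fun ω hω => ?_) ht⟩
    exact hss hω
  · rintro s s' ⟨N, hN, h⟩ ⟨N', hN', h'⟩
    refine ⟨N + N', by linarith, ?_⟩
    filter_upwards [h, h'] with t ht ht'
    have := measureReal_union_le (μ := μ t) {ω | (t : ℝ)⁻¹ • S t ω ∈ s}
      {ω | (t : ℝ)⁻¹ • S t ω ∈ s'}
    rw [add_mul]
    exact this.trans (add_le_add ht ht')
  · intro x hx
    obtain ⟨ε, hε, h⟩ := h x hx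
    refine ⟨Metric.closedBall x ε, mem_nhdsWithin_of_mem_nhds (Metric.closedBall_mem_nhds x hε),
      1, le_rfl, ?_⟩
    filter_upwards [h, eventually_ge_atTop 1] with t ht ht1
    rw [one_mul]
    refine le_trans (measureReal_mono fun ω hω => ?_) ht
    have h1 : (0 : ℝ) < t := by exact_mod_cast ht1
    have h2 : S t ω - (t : ℝ) • x = (t : ℝ) • ((t : ℝ)⁻¹ • S t ω - x) := by
      rw [smul_sub, smul_inv_smul₀ h1.ne']
    change ‖S t ω - (t : ℝ) • x‖ ≤ ε * t
    rw [h2, norm_smul, Real.norm_of_nonneg h1.le, mul_comm]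
    exact mul_le_mul_of_nonneg_right (by simpa [dist_eq_norm] using hω) h1.le

/-- Outside the asymptotic epigraph the lower bound fails for all large times, and not merely
infinitely often. For a large deviation principle this says that the lower and the upper local
rates agree. -/
def EventualDichotomy (P : Measure Ω) (S : ℕ → Ω → E) : Prop :=
  ∀ z ∉ asymptoticEpigraph P S, ∃ ε > 0, ∀ᶠ t : ℕ in atTop, ¬ ExpLowerBound P S z ε t

lemma exists_eventually_measureReal_le [IsProbabilityMeasure P] (hdich : EventualDichotomy P S)
    {K : Set E} (hK : IsCompact K) {b : ℝ} (hb : ∀ x ∈ K, (x, b) ∉ asymptoticEpigraph P S) :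
    ∃ N : ℝ, 1 ≤ N ∧ ∀ᶠ t : ℕ in atTop,
      P.real {ω | (t : ℝ)⁻¹ • S t ω ∈ K} ≤ N * Real.exp (t * -b) := by
  refine exists_eventually_measureReal_le_of_isCompact (μ := fun _ => P) hK _ fun x hx => ?_
  obtain ⟨ε, hε, h⟩ := hdich _ (hb x hx)
  refine ⟨ε, hε, h.mono fun t ht => (not_le.1 ht).le.trans (Real.exp_le_exp.2 ?_)⟩
  have : (0 : ℝ) ≤ t * ε := by positivity
  dsimp only
  linarith

/-! ### The scaled cumulant generating function -/

lemma inner_le_of_norm_sub_le {α x y : E} {r : ℝ} (h : ‖y - x‖ ≤ r) :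
    inner ℝ α y ≤ inner ℝ α x + ‖α‖ * r := by
  have h1 : inner ℝ α y = inner ℝ α x + inner ℝ α (y - x) := by rw [inner_sub_right]; ring
  have h2 := real_inner_le_norm α (y - x)
  have h3 := mul_le_mul_of_nonneg_left h (norm_nonneg α)
  linarith

section MGF

variable [MeasurableSpace E] [BorelSpace E] [SecondCountableTopology E]

lemma integrable_exp_inner [IsFiniteMeasure P] (hSm : ∀ t, Measurable (S t))
    (hS : ∀ t ω, ‖S t ω‖ ≤ t * R) (α : E) (t : ℕ) :
    Integrable (fun ω => Real.exp (inner ℝ α (S t ω))) P := by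
  refine Integrable.of_bound (C := Real.exp (‖α‖ * (t * R))) ?_ (ae_of_all _ fun ω => ?_)
  · have := hSm t
    exact (Real.measurable_exp.comp (Measurable.inner measurable_const this)).aestronglyMeasurable
  · rw [Real.norm_of_nonneg (Real.exp_nonneg _), Real.exp_le_exp]
    exact (real_inner_le_norm _ _).trans (mul_le_mul_of_nonneg_left (hS t ω) (norm_nonneg _))

/-- The moment generating function is bounded by the supremum of `(α, x) - a` over the asymptotic
epigraph. The exponential bounds on small balls are applied to the tilted measures
`exp (α, S t) dP`. -/
lemma exists_eventually_integral_exp_le [ProperSpace E] [IsProbabilityMeasure P]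
    (hSm : ∀ t, Measurable (S t)) (hS : ∀ t ω, ‖S t ω‖ ≤ t * R)
    (hdich : EventualDichotomy P S) (α : E) {Q : ℝ}
    (hQ : ∀ z ∈ asymptoticEpigraph P S, inner ℝ α z.1 - z.2 < Q) :
    ∃ N : ℝ, 1 ≤ N ∧ ∀ᶠ t : ℕ in atTop,
      ∫ ω, Real.exp (inner ℝ α (S t ω)) ∂P ≤ N * Real.exp (t * Q) := by
  have hint := integrable_exp_inner (P := P) hSm hS α
  let μ : ℕ → Measure Ω := fun t =>
    P.withDensity fun ω => ENNReal.ofReal (Real.exp (inner ℝ α (S t ω)))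
  have hfin : ∀ t, IsFiniteMeasure (μ t) := fun t =>
    isFiniteMeasure_withDensity_ofReal (hint t).2
  have hμ : ∀ t s, MeasurableSet s →
      (μ t).real s = ∫ ω in s, Real.exp (inner ℝ α (S t ω)) ∂P := by
    intro t s hs
    rw [integral_eq_lintegral_of_nonneg_ae (ae_of_all _ fun ω => Real.exp_nonneg _)
      (hint t).1.restrict, Measure.real, withDensity_apply _ hs]
  obtain ⟨N, hN, h⟩ := exists_eventually_measureReal_le_of_isCompact (μ := μ) (S := S)
    (isCompact_closedBall (0 : E) R) Q fun x _ => by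
      have hx : (x, inner ℝ α x - Q) ∉ asymptoticEpigraph P S := fun hx => by
        have := hQ _ hx
        simp at this
      obtain ⟨ε, hε, h⟩ := hdich _ hx
      have hα : 0 < ‖α‖ + 1 := by positivity
      refine ⟨ε / (‖α‖ + 1), by positivity, h.mono fun t ht => ?_⟩
      have ht' : (0 : ℝ) ≤ t := t.cast_nonneg
      have hmeas : MeasurableSet {ω | ‖S t ω - (t : ℝ) • x‖ ≤ ε / (‖α‖ + 1) * t} :=
        measurableSet_le ((hSm t).sub_const _).norm measurable_const
      have hle : ε / (‖α‖ + 1) ≤ ε := div_le_self hε.le (by linarith [norm_nonneg α])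
      have hαε : ‖α‖ * (ε / (‖α‖ + 1)) ≤ ε := by
        rw [mul_div_assoc', div_le_iff₀ hα]
        nlinarith [norm_nonneg α]
      rw [hμ t _ hmeas]
      calc ∫ ω in {ω | ‖S t ω - (t : ℝ) • x‖ ≤ ε / (‖α‖ + 1) * t},
            Real.exp (inner ℝ α (S t ω)) ∂P
          ≤ ∫ ω in {ω | ‖S t ω - (t : ℝ) • x‖ ≤ ε / (‖α‖ + 1) * t},
            Real.exp (t * (inner ℝ α x + ε)) ∂P := by
            refine setIntegral_mono_on (hint t).integrableOn (integrable_const _).integrableOn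
              hmeas fun ω hω => Real.exp_le_exp.2 ?_
            refine (inner_le_of_norm_sub_le hω).trans ?_
            rw [inner_smul_right]
            nlinarith
        _ = P.real {ω | ‖S t ω - (t : ℝ) • x‖ ≤ ε / (‖α‖ + 1) * t} *
            Real.exp (t * (inner ℝ α x + ε)) := by
            rw [setIntegral_const, smul_eq_mul]
        _ ≤ Real.exp (-(t * (inner ℝ α x - Q + ε))) * Real.exp (t * (inner ℝ α x + ε)) := by
            gcongr
            refine le_trans (measureReal_mono fun ω hω => ?_) (not_le.1 ht).le
            exact le_trans hω (mul_le_mul_of_nonneg_right hle ht')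
        _ = Real.exp (t * Q) := by rw [← Real.exp_add]; congr 1; ring
  refine ⟨N, hN, ?_⟩
  filter_upwards [h, eventually_ge_atTop 1] with t ht ht1
  have h1 : (0 : ℝ) < t := by exact_mod_cast ht1
  have huniv : {ω | (t : ℝ)⁻¹ • S t ω ∈ Metric.closedBall (0 : E) R} = Set.univ := by
    refine Set.eq_univ_of_forall fun ω => ?_
    rw [Set.mem_ofPred_eq, mem_closedBall_zero_iff, norm_smul, norm_inv,
      Real.norm_of_nonneg h1.le, inv_mul_le_iff₀ h1]
    exact hS t ω
  rw [huniv, hμ t _ MeasurableSet.univ, Measure.restrict_univ] at ht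
  exact ht

lemma eventually_le_integral_exp [IsProbabilityMeasure P]
    (hSm : ∀ t, Measurable (S t)) (hS : ∀ t ω, ‖S t ω‖ ≤ t * R) (α : E)
    (hz : z ∈ asymptoticEpigraph P S) {η : ℝ} (hη : 0 < η) :
    ∀ᶠ t : ℕ in atTop, Real.exp (t * (inner ℝ α z.1 - z.2 - η)) ≤
      ∫ ω, Real.exp (inner ℝ α (S t ω)) ∂P := by
  have hα : 0 < ‖α‖ + 1 := by positivity
  filter_upwards [hz (η / (‖α‖ + 1)) (by positivity)] with t ht
  have ht' : (0 : ℝ) ≤ t := t.cast_nonneg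
  set ε := η / (‖α‖ + 1) with hε
  have hεη : ‖α‖ * ε + ε = η := by rw [hε]; field_simp
  have hint := integrable_exp_inner (P := P) hSm hS α t
  have hmeas : MeasurableSet {ω | ‖S t ω - (t : ℝ) • z.1‖ ≤ ε * t} :=
    measurableSet_le ((hSm t).sub_const _).norm measurable_const
  calc Real.exp (t * (inner ℝ α z.1 - z.2 - η))
      = Real.exp (-(t * (z.2 + ε))) * Real.exp (t * (inner ℝ α z.1 - ‖α‖ * ε)) := by
        rw [← Real.exp_add, ← hεη]; congr 1; ring
    _ ≤ P.real {ω | ‖S t ω - (t : ℝ) • z.1‖ ≤ ε * t} *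
        Real.exp (t * (inner ℝ α z.1 - ‖α‖ * ε)) := by gcongr; exact ht
    _ = ∫ ω in {ω | ‖S t ω - (t : ℝ) • z.1‖ ≤ ε * t},
        Real.exp (t * (inner ℝ α z.1 - ‖α‖ * ε)) ∂P := by rw [setIntegral_const, smul_eq_mul]
    _ ≤ ∫ ω in {ω | ‖S t ω - (t : ℝ) • z.1‖ ≤ ε * t}, Real.exp (inner ℝ α (S t ω)) ∂P := by
        refine setIntegral_mono_on (integrable_const _).integrableOn hint.integrableOn
          hmeas fun ω hω => Real.exp_le_exp.2 ?_
        have h1 := inner_le_of_norm_sub_le (α := α) (x := S t ω) (y := (t : ℝ) • z.1)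
          (r := ε * t) (by rw [norm_sub_rev]; exact hω)
        rw [inner_smul_right] at h1
        linarith
    _ ≤ ∫ ω, Real.exp (inner ℝ α (S t ω)) ∂P :=
        setIntegral_le_integral hint (ae_of_all _ fun ω => Real.exp_nonneg _)

/-- If the epigraph were empty, the total mass `∫ exp 0 dP = 1` would decay exponentially. -/
lemma asymptoticEpigraph_nonempty [ProperSpace E] [IsProbabilityMeasure P]
    (hSm : ∀ t, Measurable (S t)) (hS : ∀ t ω, ‖S t ω‖ ≤ t * R)
    (hdich : EventualDichotomy P S) : (asymptoticEpigraph P S).Nonempty := by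
  by_contra hne
  rw [Set.not_nonempty_iff_eq_empty] at hne
  obtain ⟨N, -, h⟩ := exists_eventually_integral_exp_le (P := P) hSm hS hdich (0 : E) (Q := -1)
    (by simp [hne])
  have hlim : Tendsto (fun t : ℕ => N * Real.exp (t * (-1 : ℝ))) atTop (𝓝 (N * 0)) := by
    refine Tendsto.const_mul _ ?_
    simp only [mul_neg_one]
    exact Real.tendsto_exp_neg_atTop_nhds_zero.comp tendsto_natCast_atTop_atTop
  rw [mul_zero] at hlim
  obtain ⟨t, ht, ht'⟩ := (h.and (hlim.eventually_lt_const one_pos)).exists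
  simp at ht ht'
  linarith

end MGF

/-- The convex conjugate `α ↦ sup ((α, x) - a)` of the asymptotic epigraph, the supremum running
over its points `(x, a)`. -/
noncomputable def epigraphConjugate (P : Measure Ω) (S : ℕ → Ω → E) (α : E) : ℝ :=
  ⨆ z : asymptoticEpigraph P S, (inner ℝ α z.1.1 - z.1.2)

lemma inner_sub_le_of_mem [IsProbabilityMeasure P] (hS : ∀ t ω, ‖S t ω‖ ≤ t * R)
    (hz : z ∈ asymptoticEpigraph P S) (α : E) : inner ℝ α z.1 - z.2 ≤ ‖α‖ * R := by
  have h1 := real_inner_le_norm α z.1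
  have h2 := mul_le_mul_of_nonneg_left (norm_fst_le_of_mem_asymptoticEpigraph hS hz)
    (norm_nonneg α)
  linarith [snd_nonneg_of_mem_asymptoticEpigraph hz]

lemma le_epigraphConjugate [IsProbabilityMeasure P] (hS : ∀ t ω, ‖S t ω‖ ≤ t * R)
    (hz : z ∈ asymptoticEpigraph P S) (α : E) :
    inner ℝ α z.1 - z.2 ≤ epigraphConjugate P S α :=
  le_ciSup (f := fun z : asymptoticEpigraph P S => (inner ℝ α z.1.1 - z.1.2 : ℝ))
    ⟨‖α‖ * R, by rintro _ ⟨z, rfl⟩; exact inner_sub_le_of_mem hS z.2 α⟩ ⟨z, hz⟩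

lemma epigraphConjugate_le (hne : (asymptoticEpigraph P S).Nonempty) {α : E} {b : ℝ}
    (h : ∀ z ∈ asymptoticEpigraph P S, inner ℝ α z.1 - z.2 ≤ b) :
    epigraphConjugate P S α ≤ b :=
  have := hne.to_subtype
  ciSup_le fun z => h z.1 z.2

lemma convexOn_epigraphConjugate [IsProbabilityMeasure P] (hS : ∀ t ω, ‖S t ω‖ ≤ t * R)
    (hne : (asymptoticEpigraph P S).Nonempty) :
    ConvexOn ℝ Set.univ (epigraphConjugate P S) := by
  refine ⟨convex_univ, fun α _ β _ a b ha hb hab => epigraphConjugate_le hne fun z hz => ?_⟩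
  have h1 := mul_le_mul_of_nonneg_left (le_epigraphConjugate hS hz α) ha
  have h2 := mul_le_mul_of_nonneg_left (le_epigraphConjugate hS hz β) hb
  rw [inner_add_left, real_inner_smul_left, real_inner_smul_left, smul_eq_mul, smul_eq_mul]
  have : z.2 = a * z.2 + b * z.2 := by rw [← add_mul, hab, one_mul]
  linarith

lemma lipschitzWith_epigraphConjugate {K : NNReal} [IsProbabilityMeasure P]
    (hS : ∀ t ω, ‖S t ω‖ ≤ t * K) (hne : (asymptoticEpigraph P S).Nonempty) :
    LipschitzWith K (epigraphConjugate P S) := by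
  refine LipschitzWith.of_le_add_mul _ fun α β => epigraphConjugate_le hne fun z hz => ?_
  have h1 := real_inner_le_norm (α - β) z.1
  have h2 := mul_le_mul_of_nonneg_left (norm_fst_le_of_mem_asymptoticEpigraph hS hz)
    (norm_nonneg (α - β))
  rw [inner_sub_left] at h1
  rw [dist_eq_norm]
  linarith [le_epigraphConjugate hS hz β]

lemma tendsto_log_integral_exp [ProperSpace E] [MeasurableSpace E] [BorelSpace E]
    [SecondCountableTopology E] [IsProbabilityMeasure P]
    (hSm : ∀ t, Measurable (S t)) (hS : ∀ t ω, ‖S t ω‖ ≤ t * R)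
    (hdich : EventualDichotomy P S) (α : E) :
    Tendsto (fun t : ℕ => (1 / (t : ℝ)) *
      Real.log (∫ ω, Real.exp (inner ℝ α (S t ω)) ∂P)) atTop (𝓝 (epigraphConjugate P S α)) := by
  have hne := asymptoticEpigraph_nonempty hSm hS hdich
  have hpos : ∀ t, 0 < ∫ ω, Real.exp (inner ℝ α (S t ω)) ∂P := fun t =>
    integral_exp_pos (integrable_exp_inner hSm hS α t)
  refine tendsto_order.2 ⟨fun b hb => ?_, fun b hb => ?_⟩
  · have := hne.to_subtype
    obtain ⟨z, hz⟩ := exists_lt_of_lt_ciSup hb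
    filter_upwards [eventually_le_integral_exp hSm hS α z.2
      (η := (inner ℝ α z.1.1 - z.1.2 - b) / 2) (by linarith), eventually_gt_atTop 0] with t ht ht0
    have ht0' : (0 : ℝ) < t := by exact_mod_cast ht0
    have h1 := (Real.le_log_iff_exp_le (hpos t)).2 ht
    rw [one_div, lt_inv_mul_iff₀ ht0']
    refine lt_of_lt_of_le ?_ h1
    exact mul_lt_mul_of_pos_left (by linarith) ht0'
  · obtain ⟨Q, hQ, hQb⟩ := exists_between hb
    obtain ⟨N, hN, h⟩ := exists_eventually_integral_exp_le hSm hS hdich α (Q := Q)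
      fun z hz => (le_epigraphConjugate hS hz α).trans_lt hQ
    filter_upwards [h, eventually_gt_atTop 0,
      (tendsto_const_div_atTop_nhds_zero_nat (Real.log N)).eventually_lt_const
        (sub_pos.2 hQb)] with t ht ht0 hlim
    have ht0' : (0 : ℝ) < t := by exact_mod_cast ht0
    have h1 := Real.log_le_log (hpos t) ht
    rw [Real.log_mul (by linarith) (Real.exp_ne_zero _), Real.log_exp] at h1
    rw [div_lt_iff₀ ht0'] at hlim
    rw [one_div, inv_mul_lt_iff₀ ht0']
    nlinarith

/-! ### Fenchel duality and the large deviation principle -/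

/-- Fenchel–Moreau for the asymptotic epigraph. A hyperplane separating `(x, a)` from the
epigraph may be vertical; since the epigraph lies above the horizontal hyperplane at height `0`,
adding a small multiple of the latter makes it non-vertical. -/
lemma legendreTransform_le_iff [CompleteSpace E] [IsProbabilityMeasure P]
    (hS : ∀ t ω, ‖S t ω‖ ≤ t * R) (hne : (asymptoticEpigraph P S).Nonempty)
    (hconv : Convex ℝ (asymptoticEpigraph P S)) (x : E) (a : ℝ) :
    legendreTransform (epigraphConjugate P S) x ≤ (a : EReal) ↔
      (x, a) ∈ asymptoticEpigraph P S := by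
  constructor
  · intro h
    have h' : ∀ α : E, inner ℝ α x - epigraphConjugate P S α ≤ a := fun α =>
      EReal.coe_le_coe_iff.1 (le_trans
        (le_iSup (fun α : E => ((inner ℝ α x - epigraphConjugate P S α : ℝ) : EReal)) α) h)
    by_contra hx
    obtain ⟨g, u, hgx, hg⟩ := geometric_hahn_banach_point_closed hconv
      isClosed_asymptoticEpigraph hx
    let ℓ : E →L[ℝ] ℝ := g.comp (ContinuousLinearMap.inl ℝ E ℝ)
    let β : ℝ := g (0, 1)
    have hg_eq : ∀ z : E × ℝ, g z = ℓ z.1 + β * z.2 := by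
      intro z
      have : z = (z.1, (0 : ℝ)) + z.2 • ((0 : E), (1 : ℝ)) := by ext <;> simp
      conv_lhs => rw [this]
      rw [map_add, map_smul, smul_eq_mul, mul_comm]
      rfl
    obtain ⟨v, hv⟩ : ∃ v : E, ∀ y, ℓ y = inner ℝ v y :=
      ⟨(InnerProductSpace.toDual ℝ E).symm ℓ, fun y => by simp⟩
    -- A separating functional with positive vertical part yields an affine minorant of slope
    -- `-s⁻¹ v` whose value at `x` exceeds `a`.
    have key : ∀ (v : E) (s r : ℝ), 0 < s → inner ℝ v x + s * a < r →
        (∀ z ∈ asymptoticEpigraph P S, r ≤ inner ℝ v z.1 + s * z.2) → False := by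
      intro v s r hs hlt hz
      have h1 : epigraphConjugate P S (-(s⁻¹ • v)) ≤ -(s⁻¹ * r) := by
        refine epigraphConjugate_le hne fun z hz' => ?_
        rw [inner_neg_left, real_inner_smul_left]
        have h2 := mul_le_mul_of_nonneg_left (hz z hz') (inv_nonneg.2 hs.le)
        rw [mul_add, inv_mul_cancel_left₀ hs.ne'] at h2
        linarith
      have h2 := h' (-(s⁻¹ • v))
      rw [inner_neg_left, real_inner_smul_left] at h2
      have h3 := mul_lt_mul_of_pos_left hlt (inv_pos.2 hs)
      rw [mul_add, inv_mul_cancel_left₀ hs.ne'] at h3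
      linarith
    have hβ : 0 ≤ β := by
      obtain ⟨z, hz⟩ := hne
      by_contra! hβ
      have h1 := hg _ (mem_asymptoticEpigraph_of_le (x := z.1) (a := z.2)
        (b := z.2 + |u - g z| / (-β)) hz
        (le_add_of_nonneg_right (div_nonneg (abs_nonneg _) (by linarith))))
      rw [hg_eq] at h1
      have h2 : β * (z.2 + |u - g z| / (-β)) = β * z.2 - |u - g z| := by
        have := hβ.ne
        field_simp
        ring
      simp only [h2] at h1
      have h3 := hg_eq z
      have h4 := neg_abs_le (u - g z)
      have h5 := le_abs_self (u - g z)
      have h6 := hg z hz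
      rw [abs_sub_comm, abs_of_pos (by linarith)] at h1
      linarith
    rw [hg_eq] at hgx
    -- A small multiple `δ` of the vertical functional, nonnegative on the epigraph, is added.
    obtain ⟨δ, hδ, hδa⟩ : ∃ δ > 0, ℓ x + (β + δ) * a < u := by
      refine ⟨(u - (ℓ x + β * a)) / (2 * (|a| + 1)), div_pos (by linarith) (by positivity), ?_⟩
      have h1 : (u - (ℓ x + β * a)) / (2 * (|a| + 1)) * a ≤ (u - (ℓ x + β * a)) / 2 := by
        rw [div_mul_eq_mul_div, div_le_div_iff₀ (by positivity) two_pos]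
        nlinarith [le_abs_self a, abs_nonneg a]
      dsimp only at hgx
      linarith
    refine key v (β + δ) u (by linarith) (by rw [← hv]; exact hδa) fun z hz => ?_
    have h1 := hg z hz
    rw [hg_eq, hv] at h1
    have := mul_nonneg hδ.le (snd_nonneg_of_mem_asymptoticEpigraph hz)
    linarith
  · intro h
    refine iSup_le fun α => EReal.coe_le_coe_iff.2 ?_
    have := le_epigraphConjugate hS h α
    dsimp only at this
    linarith

lemma legendreTransform_nonneg {q : E → ℝ} (hq : q 0 ≤ 0) (x : E) :
    0 ≤ legendreTransform q x := by
  refine le_trans ?_ (le_iSup (fun α : E => ((inner ℝ α x - q α : ℝ) : EReal)) 0)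
  rw [inner_zero_left]
  exact EReal.coe_nonneg.2 (by linarith)

lemma isConvexFunction_legendreTransform (q : E → ℝ) :
    IsConvexFunction (legendreTransform q) := by
  intro x y a b ha hb hab
  refine iSup_le fun α => ?_
  have h : (inner ℝ α (a • x + b • y) - q α : ℝ) =
      a * (inner ℝ α x - q α) + b * (inner ℝ α y - q α) := by
    rw [inner_add_right, inner_smul_right, inner_smul_right]
    have : q α = a * q α + b * q α := by rw [← add_mul, hab, one_mul]
    linarith
  rw [h, EReal.coe_add, EReal.coe_mul, EReal.coe_mul]
  exact add_le_add
    (mul_le_mul_of_nonneg_left (le_iSup (fun α : E => ((inner ℝ α x - q α : ℝ) : EReal)) α)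
      (EReal.coe_nonneg.2 ha))
    (mul_le_mul_of_nonneg_left (le_iSup (fun α : E => ((inner ℝ α y - q α : ℝ) : EReal)) α)
      (EReal.coe_nonneg.2 hb))

lemma lowerSemicontinuous_legendreTransform (q : E → ℝ) :
    LowerSemicontinuous (legendreTransform q) := by
  refine lowerSemicontinuous_iSup fun α => Continuous.lowerSemicontinuous ?_
  exact continuous_coe_real_ereal.comp (by fun_prop)

lemma isGoodRateFunction_legendreTransform [ProperSpace E] [IsProbabilityMeasure P]
    (hS : ∀ t ω, ‖S t ω‖ ≤ t * R) (hne : (asymptoticEpigraph P S).Nonempty)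
    (hconv : Convex ℝ (asymptoticEpigraph P S)) :
    IsGoodRateFunction (legendreTransform (epigraphConjugate P S)) := by
  refine ⟨⟨lowerSemicontinuous_legendreTransform _, legendreTransform_nonneg ?_⟩, fun a => ?_⟩
  · exact epigraphConjugate_le hne fun z hz => by
      simpa using snd_nonneg_of_mem_asymptoticEpigraph hz
  · refine (isCompact_closedBall (0 : E) R).of_isClosed_subset
      ((lowerSemicontinuous_legendreTransform _).isClosed_preimage (a : EReal)) fun x hx => ?_
    rw [Set.mem_ofPred_eq, legendreTransform_le_iff hS hne hconv] at hx
    simpa using norm_fst_le_of_mem_asymptoticEpigraph hS hx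

lemma inv_mul_log_ofReal_mul_exp {t : ℕ} (ht : 0 < t) {N b : ℝ} (hN : 0 < N) :
    ((1 / (t : ℝ) : ℝ) : EReal) * ENNReal.log (ENNReal.ofReal (N * Real.exp (t * b))) =
      ((Real.log N / t + b : ℝ) : EReal) := by
  have h1 : (0 : ℝ) < t := by exact_mod_cast ht
  rw [ENNReal.log_ofReal_of_pos (by positivity),
    Real.log_mul hN.ne' (Real.exp_ne_zero _), Real.log_exp, ← EReal.coe_mul]
  congr 1
  field_simp

lemma satisfiesLDP_legendreTransform [ProperSpace E] [IsProbabilityMeasure P]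
    (hS : ∀ t ω, ‖S t ω‖ ≤ t * R)
    (hdich : EventualDichotomy P S) (hne : (asymptoticEpigraph P S).Nonempty)
    (hconv : Convex ℝ (asymptoticEpigraph P S)) :
    SatisfiesLDP P (fun t ω => (t : ℝ)⁻¹ • S t ω)
      (legendreTransform (epigraphConjugate P S)) := by
  have hnonneg : ∀ x, 0 ≤ legendreTransform (epigraphConjugate P S) x :=
    (isGoodRateFunction_legendreTransform hS hne hconv).1.2
  have hmul : ∀ t : ℕ, Monotone fun y : EReal => ((1 / (t : ℝ) : ℝ) : EReal) * y := fun t y y' h =>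
    mul_le_mul_of_nonneg_left h (EReal.coe_nonneg.2 (by positivity))
  refine ⟨fun O hO => ?_, fun Γ hΓ => ?_⟩
  · rw [EReal.neg_le]
    refine le_iInf₂ fun x hx => ?_
    rw [EReal.neg_le]
    rcases eq_or_ne (legendreTransform (epigraphConjugate P S) x) ⊤ with htop | htop
    · simp [htop]
    obtain ⟨a, ha⟩ : ∃ a : ℝ, legendreTransform (epigraphConjugate P S) x = a :=
      ⟨_, (EReal.coe_toReal htop (((EReal.bot_lt_zero).trans_le (hnonneg x)).ne')).symm⟩
    have hmem := (legendreTransform_le_iff hS hne hconv x a).1 ha.le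
    rw [ha, ← EReal.coe_neg]
    refine EReal.ge_of_forall_gt_iff_ge.1 fun b hb => ?_
    have hb' : b < -a := by exact_mod_cast hb
    obtain ⟨r, hr, hball⟩ := Metric.isOpen_iff.1 hO x hx
    have hε : 0 < min (r / 2) (-a - b) := lt_min (by linarith) (by linarith)
    refine le_liminf_of_le (by isBoundedDefault) ?_
    filter_upwards [hmem _ hε, eventually_gt_atTop 0] with t ht ht0
    have ht0' : (0 : ℝ) < t := by exact_mod_cast ht0
    have h1 := inv_mul_log_ofReal_mul_exp ht0 (N := 1) (b := b) one_pos
    rw [Real.log_one, zero_div, zero_add] at h1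
    rw [← h1]
    refine hmul t (ENNReal.log_monotone (ENNReal.ofReal_le_of_le_toReal ?_))
    refine le_trans ?_ (ht.trans (measureReal_mono (fun ω hω => hball ?_)))
    · rw [one_mul]
      refine Real.exp_le_exp.2 ?_
      have := mul_le_mul_of_nonneg_left (min_le_right (r / 2) (-a - b)) ht0'.le
      dsimp only
      linarith
    · have h2 : ‖S t ω - (t : ℝ) • x‖ ≤ min (r / 2) (-a - b) * t := hω
      have h3 : S t ω - (t : ℝ) • x = (t : ℝ) • ((t : ℝ)⁻¹ • S t ω - x) := by
        rw [smul_sub, smul_inv_smul₀ ht0'.ne']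
      rw [h3, norm_smul, Real.norm_of_nonneg ht0'.le, mul_comm] at h2
      have h4 := le_of_mul_le_mul_right h2 ht0'
      rw [Metric.mem_ball, dist_eq_norm]
      linarith [min_le_left (r / 2) (-a - b)]
  · refine EReal.le_of_forall_lt_iff_le.1 fun b hb => ?_
    obtain ⟨b', hb'1, hb'2⟩ := EReal.lt_iff_exists_real_btwn.1 hb
    have hb'b : b' < b := by exact_mod_cast hb'2
    have hlt : ((-b' : ℝ) : EReal) < ⨅ x ∈ Γ, legendreTransform (epigraphConjugate P S) x := by
      rw [EReal.coe_neg]; exact EReal.neg_lt_comm.1 hb'1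
    have hK : IsCompact (Γ ∩ Metric.closedBall (0 : E) R) :=
      (isCompact_closedBall (0 : E) R).inter_left hΓ
    obtain ⟨N, hN, h⟩ := exists_eventually_measureReal_le (P := P) (S := S) hdich hK (b := -b')
      fun x hx hmem => by
        rw [← legendreTransform_le_iff hS hne hconv] at hmem
        exact absurd (hlt.trans_le (iInf₂_le x hx.1)) (not_lt.2 hmem)
    rw [neg_neg] at h
    refine limsup_le_of_le (by isBoundedDefault) ?_
    filter_upwards [h, eventually_gt_atTop 0,
      (tendsto_const_div_atTop_nhds_zero_nat (Real.log N)).eventually_lt_const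
        (sub_pos.2 hb'b)] with t ht ht0 hlim
    have ht0' : (0 : ℝ) < t := by exact_mod_cast ht0
    have hsub : {ω | (t : ℝ)⁻¹ • S t ω ∈ Γ} ⊆
        {ω | (t : ℝ)⁻¹ • S t ω ∈ Γ ∩ Metric.closedBall (0 : E) R} := fun ω hω => by
      refine ⟨hω, ?_⟩
      rw [mem_closedBall_zero_iff, norm_smul, norm_inv, Real.norm_of_nonneg ht0'.le,
        inv_mul_le_iff₀ ht0']
      exact hS t ω
    have h1 : P {ω | (t : ℝ)⁻¹ • S t ω ∈ Γ} ≤ ENNReal.ofReal (N * Real.exp (t * b')) :=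
      (measure_mono hsub).trans
        ((ENNReal.le_ofReal_iff_toReal_le (measure_ne_top _ _) (by positivity)).2 ht)
    refine (hmul t (ENNReal.log_monotone h1)).trans ?_
    dsimp only
    rw [inv_mul_log_ofReal_mul_exp ht0 (by linarith)]
    exact EReal.coe_le_coe_iff.2 (by linarith)

end Abstract

/-! ### Decoupling of events that depend on finitely many coordinates -/

section Decoupling

variable {A : Type*}

lemma iterate_shift_apply (k j : ℕ) (ω : ℕ → A) : shift^[k] ω j = ω (k + j) := by
  induction k generalizing j with
  | zero => simp
  | succ k ih => rw [Function.iterate_succ_apply', shift, ih]; congr 1; omega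

/-- The first `n` letters of a sequence. -/
def prefixMap (n : ℕ) (ω : ℕ → A) : Fin n → A := fun i => ω i

lemma mem_wordCylinder_iff {w : List A} {ω : ℕ → A} :
    ω ∈ wordCylinder w ↔ ∀ (i : ℕ) (h : i < w.length), ω i = w[i] :=
  ⟨fun h i hi => h ⟨i, hi⟩, fun h i => h i i.2⟩

lemma wordCylinder_ofFn {n : ℕ} (u : Fin n → A) :
    wordCylinder (List.ofFn u) = prefixMap n ⁻¹' {u} := by
  ext ω
  rw [mem_wordCylinder_iff, Set.mem_preimage, Set.mem_singleton_iff, funext_iff]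
  simp only [List.length_ofFn, List.getElem_ofFn]
  exact ⟨fun h i => h i i.2, fun h i hi => h ⟨i, hi⟩⟩

lemma wordCylinder_append_subset {n m : ℕ} (u : Fin n → A) (v : Fin m → A) (ξ : List A) :
    wordCylinder (List.ofFn u ++ ξ ++ List.ofFn v) ⊆
      prefixMap n ⁻¹' {u} ∩ shift^[n + ξ.length] ⁻¹' (prefixMap m ⁻¹' {v}) := by
  intro ω hω
  rw [mem_wordCylinder_iff] at hω
  refine ⟨funext fun i => ?_, funext fun i => ?_⟩
  · have h := hω i (by simp only [List.length_append, List.length_ofFn]; omega)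
    simp only [List.append_assoc] at h
    rw [List.getElem_append_left (by simp)] at h
    change ω i = u i
    simpa using h
  · have h := hω (n + ξ.length + i) (by simp only [List.length_append, List.length_ofFn]; omega)
    rw [List.getElem_append_right (by simp)] at h
    change shift^[n + ξ.length] ω i = v i
    rw [iterate_shift_apply, h]
    simp

lemma prefixMap_preimage_image {n : ℕ} {B : Set (ℕ → A)}
    (hB : DependsOn (· ∈ B) (Set.Iio n)) : prefixMap n ⁻¹' (prefixMap n '' B) = B := by
  refine Set.Subset.antisymm ?_ (Set.subset_preimage_image _ _)
  rintro ω ⟨ω', hω', h⟩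
  exact (hB fun i hi => congrFun h ⟨i, hi⟩ : (ω' ∈ B) = (ω ∈ B)).mp hω'

variable [MeasurableSpace A]

lemma measurable_shift_iterate (k : ℕ) : Measurable (shift^[k] : (ℕ → A) → ℕ → A) :=
  Measurable.iterate (measurable_pi_lambda _ fun j => measurable_pi_apply (j + 1)) k

lemma measurable_prefixMap (n : ℕ) : Measurable (prefixMap n : (ℕ → A) → Fin n → A) :=
  measurable_pi_lambda _ fun i => measurable_pi_apply (i : ℕ)

variable [Finite A] [MeasurableSingletonClass A]

/-- The decoupling inequality for words `u` of a fixed length `n`, with constants `τ` and `c`. -/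
def DecoupledAt (P : Measure (ℕ → A)) (n τ : ℕ) (c : ℝ) : Prop :=
  ∀ u v : List A, u.length = n → 1 ≤ v.length →
    ∃ ξ : List A, ξ.length ≤ τ ∧
      Real.exp (-c) * P.real (wordCylinder u) * P.real (wordCylinder v)
        ≤ P.real (wordCylinder (u ++ ξ ++ v))

/-- Decoupling with a single gap. The length of the connecting word depends on the pair of words,
but takes at most `τ + 1` values, so one of them accounts for a fraction `1 / (τ + 1)` of the total
mass. -/
lemma DecoupledAt.exists_gap {P : Measure (ℕ → A)} [IsFiniteMeasure P] {n τ : ℕ} {c : ℝ}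
    (h : DecoupledAt P n τ c) {m : ℕ} (hm : 1 ≤ m) {B C : Set (ℕ → A)}
    (hC : DependsOn (· ∈ C) (Set.Iio n)) (hB : DependsOn (· ∈ B) (Set.Iio m)) :
    ∃ k ≤ τ, Real.exp (-c) / (τ + 1) * (P.real C * P.real B) ≤
      P.real (C ∩ shift^[n + k] ⁻¹' B) := by
  classical
  have := Fintype.ofFinite A
  let U : Finset (Fin n → A) := (prefixMap n '' C).toFinset
  let V : Finset (Fin m → A) := (prefixMap m '' B).toFinset
  have hU : ∑ u ∈ U, P.real (prefixMap n ⁻¹' {u}) = P.real C := by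
    rw [sum_measureReal_preimage_singleton _
      fun y _ => measurable_prefixMap n (measurableSet_singleton y), Set.coe_toFinset,
      prefixMap_preimage_image hC]
  have hV : ∑ v ∈ V, P.real (prefixMap m ⁻¹' {v}) = P.real B := by
    rw [sum_measureReal_preimage_singleton _
      fun y _ => measurable_prefixMap m (measurableSet_singleton y), Set.coe_toFinset,
      prefixMap_preimage_image hB]
  have hUV : ∀ k, ∑ p ∈ U ×ˢ V,
      P.real (prefixMap n ⁻¹' {p.1} ∩ shift^[n + k] ⁻¹' (prefixMap m ⁻¹' {p.2})) =
      P.real (C ∩ shift^[n + k] ⁻¹' B) := by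
    intro k
    have hmeas : Measurable fun ω : ℕ → A => (prefixMap n ω, prefixMap m (shift^[n + k] ω)) :=
      (measurable_prefixMap n).prodMk
        ((measurable_prefixMap m).comp (measurable_shift_iterate (n + k)))
    have h1 := sum_measureReal_preimage_singleton (μ := P) (U ×ˢ V)
      (f := fun ω : ℕ → A => (prefixMap n ω, prefixMap m (shift^[n + k] ω)))
      fun y _ => hmeas (measurableSet_singleton y)
    have h2 : (fun ω : ℕ → A => (prefixMap n ω, prefixMap m (shift^[n + k] ω))) ⁻¹'
        ((U ×ˢ V : Finset _) : Set _) = C ∩ shift^[n + k] ⁻¹' B := by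
      rw [Finset.coe_product, Set.coe_toFinset, Set.coe_toFinset, Set.mk_preimage_prod,
        prefixMap_preimage_image hC, ← Set.preimage_preimage (g := prefixMap m),
        prefixMap_preimage_image hB]
    rw [← h2, ← h1]
    refine Finset.sum_congr rfl fun p _ => ?_
    congr 1
    ext ω
    simp [Prod.ext_iff]
  have hpair : ∀ (u : Fin n → A) (v : Fin m → A),
      Real.exp (-c) * P.real (prefixMap n ⁻¹' {u}) * P.real (prefixMap m ⁻¹' {v}) ≤
        ∑ k ∈ Finset.range (τ + 1),
          P.real (prefixMap n ⁻¹' {u} ∩ shift^[n + k] ⁻¹' (prefixMap m ⁻¹' {v})) := by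
    intro u v
    obtain ⟨ξ, hξ, hle⟩ := h (List.ofFn u) (List.ofFn v) (by simp) (by simpa using hm)
    rw [wordCylinder_ofFn, wordCylinder_ofFn] at hle
    refine (hle.trans (measureReal_mono (wordCylinder_append_subset u v ξ))).trans ?_
    exact Finset.single_le_sum (f := fun k =>
      P.real (prefixMap n ⁻¹' {u} ∩ shift^[n + k] ⁻¹' (prefixMap m ⁻¹' {v})))
      (fun k _ => measureReal_nonneg) (Finset.mem_range.2 (by omega))
  have htotal : Real.exp (-c) * (P.real C * P.real B) ≤
      ∑ k ∈ Finset.range (τ + 1), P.real (C ∩ shift^[n + k] ⁻¹' B) := by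
    simp_rw [← hUV]
    rw [Finset.sum_comm, ← hU, ← hV, Finset.sum_mul_sum, ← Finset.sum_product', Finset.mul_sum]
    refine Finset.sum_le_sum fun p _ => ?_
    rw [← mul_assoc]
    exact hpair p.1 p.2
  obtain ⟨k, hk, hle⟩ := Finset.exists_le_of_sum_le
    (s := Finset.range (τ + 1))
    (f := fun _ => Real.exp (-c) / (τ + 1) * (P.real C * P.real B))
    (g := fun k => P.real (C ∩ shift^[n + k] ⁻¹' B)) (by simp) (by
      refine le_trans (le_of_eq ?_) htotal
      rw [Finset.sum_const, Finset.card_range, nsmul_eq_mul]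
      push_cast
      field_simp)
  exact ⟨k, Nat.lt_succ_iff.1 (Finset.mem_range.1 hk), hle⟩

end Decoupling

/-! ### Concatenation of blocks -/

section Gluing

variable {A E : Type*} [NormedAddCommGroup E]

lemma norm_birkhoffSum_le {X : Type*} {φ : X → X} {f : X → E} {R : ℝ} (hR : ∀ x, ‖f x‖ ≤ R)
    (t : ℕ) (x : X) : ‖birkhoffSum φ f t x‖ ≤ t * R := by
  refine (norm_sum_le_of_le _ fun k _ => hR _).trans ?_
  simp

lemma norm_birkhoffSum_sub_le {X : Type*} {φ : X → X} {f : X → E} {R : ℝ} (hR : ∀ x, ‖f x‖ ≤ R)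
    {s t : ℕ} (hst : s ≤ t) (x : X) :
    ‖birkhoffSum φ f t x - birkhoffSum φ f s x‖ ≤ ((t : ℝ) - s) * R := by
  obtain ⟨k, rfl⟩ := Nat.exists_eq_add_of_le hst
  rw [birkhoffSum_add, add_sub_cancel_left]
  simpa using norm_birkhoffSum_le (φ := φ) hR k (φ^[s] x)

/-- Distortion: Birkhoff sums of a continuous function over a block vary by `o(n)` among sequences
that share their first `n` letters. -/
lemma eventually_norm_birkhoffSum_sub_le [Finite A] [TopologicalSpace A]
    [DiscreteTopology A] (f : C(ℕ → A, E)) {ε : ℝ} (hε : 0 < ε) :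
    ∀ᶠ n : ℕ in atTop, ∀ ω ω' : ℕ → A, (∀ i < n, ω i = ω' i) →
      ‖birkhoffSum shift f n ω - birkhoffSum shift f n ω'‖ ≤ ε * n := by
  obtain ⟨m, hm⟩ : ∃ m : ℕ, ∀ ω ω' : ℕ → A, (∀ i < m, ω i = ω' i) → ‖f ω - f ω'‖ ≤ ε / 2 := by
    let _ : MetricSpace (ℕ → A) := PiNat.metricSpace
    have huc := CompactSpace.uniformContinuous_of_continuous f.continuous
    obtain ⟨δ, hδ, h⟩ := Metric.uniformContinuous_iff.1 huc (ε / 2) (by positivity)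
    obtain ⟨m, hm⟩ := exists_pow_lt_of_lt_one hδ (by norm_num : (1 / 2 : ℝ) < 1)
    refine ⟨m, fun ω ω' hω => ?_⟩
    rw [← dist_eq_norm]
    refine (h (lt_of_le_of_lt ?_ hm)).le
    exact PiNat.mem_cylinder_iff_dist_le.1 hω
  filter_upwards [tendsto_natCast_atTop_atTop.eventually_ge_atTop (m * (2 * ‖f‖) / (ε / 2))]
    with n hn ω ω' hω
  rw [div_le_iff₀ (by positivity)] at hn
  have hterm : ∀ k ∈ Finset.range n, ‖f (shift^[k] ω) - f (shift^[k] ω')‖ ≤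
      ε / 2 + if n ≤ k + m then 2 * ‖f‖ else 0 := by
    intro k hk
    split_ifs with hkm
    · have := norm_sub_le (f (shift^[k] ω)) (f (shift^[k] ω'))
      linarith [f.norm_coe_le_norm (shift^[k] ω), f.norm_coe_le_norm (shift^[k] ω')]
    · rw [add_zero]
      refine hm _ _ fun i hi => ?_
      rw [iterate_shift_apply, iterate_shift_apply]
      exact hω _ (by omega)
  rw [birkhoffSum, birkhoffSum, ← Finset.sum_sub_distrib]
  refine (norm_sum_le_of_le _ hterm).trans ?_
  rw [Finset.sum_add_distrib, ← Finset.sum_filter, Finset.sum_const, Finset.sum_const,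
    Finset.card_range, nsmul_eq_mul, nsmul_eq_mul]
  have hcard : ((Finset.range n).filter fun k => n ≤ k + m).card ≤ m := by
    calc _ ≤ (Finset.Ico (n - m) n).card := Finset.card_le_card fun k hk => by
          simp only [Finset.mem_filter, Finset.mem_range, Finset.mem_Ico] at hk ⊢
          omega
      _ ≤ m := by rw [Nat.card_Ico]; omega
  have hcard' : (((Finset.range n).filter fun k => n ≤ k + m).card : ℝ) ≤ m := by
    exact_mod_cast hcard
  have := mul_le_mul_of_nonneg_right hcard' (by positivity : 0 ≤ 2 * ‖f‖)
  linarith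

variable [NormedSpace ℝ E] [Finite A] [MeasurableSpace A] [MeasurableSingletonClass A]

/-- Given target values `z i` that the Birkhoff sums over blocks of length `n` attain with
probability at least `exp (-n (z i).2)`, `N` such blocks can be placed one after another, with gaps
of length at most `τ`, at a cost of `exp (-n δ)` for each block. Blocks are added on the left, since
the constants of the decoupling condition depend on the length of the left word only. -/
lemma DecoupledAt.exists_concatenation {P : Measure (ℕ → A)} [IsProbabilityMeasure P] {n τ : ℕ}
    {c δ : ℝ} (h : DecoupledAt P n τ c)
    (hδ : Real.exp (-(n * δ)) ≤ Real.exp (-c) / (τ + 1)) {f : (ℕ → A) → E} {R r : ℝ}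
    (hR : ∀ ω, ‖f ω‖ ≤ R)
    (hr : ∀ ω ω' : ℕ → A, (∀ i < n, ω i = ω' i) →
      ‖birkhoffSum shift f n ω - birkhoffSum shift f n ω'‖ ≤ r)
    (z : ℕ → E × ℝ)
    (hz : ∀ i, Real.exp (-(n * (z i).2)) ≤
      P.real {ω | ‖birkhoffSum shift f n ω - (n : ℝ) • (z i).1‖ ≤ r}) (N : ℕ) :
    ∃ (M m : ℕ) (B : Set (ℕ → A)), 1 ≤ m ∧ DependsOn (· ∈ B) (Set.Iio m) ∧
      N * n ≤ M ∧ M ≤ N * (n + τ) ∧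
      Real.exp (-(n * ∑ i ∈ Finset.range N, ((z i).2 + δ))) ≤ P.real B ∧
      ∀ ω ∈ B, ‖birkhoffSum shift f M ω - (n : ℝ) • ∑ i ∈ Finset.range N, (z i).1‖ ≤
        N * (2 * r + τ * R) := by
  induction N with
  | zero => exact ⟨0, 1, Set.univ, le_rfl, fun _ _ _ => rfl, by simp⟩
  | succ N ih =>
    obtain ⟨M, m, B, hm, hB, hM1, hM2, hPB, hSB⟩ := ih
    -- The event of the new block, enlarged to depend on the first `n` coordinates only.
    let C : Set (ℕ → A) := {ω | ∃ ω', (∀ i < n, ω i = ω' i) ∧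
      ‖birkhoffSum shift f n ω' - (n : ℝ) • (z N).1‖ ≤ r}
    have hC : DependsOn (· ∈ C) (Set.Iio n) := by
      refine fun ω ω' hω => propext ⟨?_, ?_⟩
      · rintro ⟨η, h1, h2⟩
        exact ⟨η, fun i hi => (hω i hi).symm.trans (h1 i hi), h2⟩
      · rintro ⟨η, h1, h2⟩
        exact ⟨η, fun i hi => (hω i hi).trans (h1 i hi), h2⟩
    have hPC : Real.exp (-(n * (z N).2)) ≤ P.real C :=
      (hz N).trans (measureReal_mono fun ω hω => ⟨ω, fun _ _ => rfl, hω⟩)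
    obtain ⟨k, hk, hle⟩ := h.exists_gap hm hC hB
    refine ⟨n + k + M, n + k + m, C ∩ shift^[n + k] ⁻¹' B, by omega, ?_, by lia, by lia, ?_, ?_⟩
    · intro ω ω' hω
      have h1 : (ω ∈ C) = (ω' ∈ C) :=
        hC fun i hi => hω i (by simp only [Set.mem_Iio] at hi ⊢; omega)
      have h2 : (shift^[n + k] ω ∈ B) = (shift^[n + k] ω' ∈ B) := hB fun i hi => by
        rw [iterate_shift_apply, iterate_shift_apply]
        exact hω _ (by simp only [Set.mem_Iio] at hi ⊢; omega)
      simp only [Set.mem_inter_iff, Set.mem_preimage, h1, h2]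
    · refine le_trans (le_of_eq ?_) ((mul_le_mul hδ (mul_le_mul hPC hPB (Real.exp_nonneg _)
        measureReal_nonneg) (by positivity) (by positivity)).trans hle)
      rw [← Real.exp_add, ← Real.exp_add, Finset.sum_range_succ]
      congr 1
      ring
    · rintro ω ⟨⟨ω', hω', hS⟩, hω⟩
      have h1 := hr ω ω' hω'
      have h2 := hSB _ hω
      have h3 : ‖birkhoffSum shift f k (shift^[n] ω)‖ ≤ τ * R :=
        (norm_birkhoffSum_le hR k _).trans (mul_le_mul_of_nonneg_right (by exact_mod_cast hk)
          ((norm_nonneg _).trans (hR ω)))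
      rw [birkhoffSum_add, birkhoffSum_add, Finset.sum_range_succ, smul_add]
      set a := birkhoffSum shift f n ω
      set a' := birkhoffSum shift f n ω'
      set b := birkhoffSum shift f k (shift^[n] ω)
      set e := birkhoffSum shift f M (shift^[n + k] ω)
      set s := (n : ℝ) • ∑ i ∈ Finset.range N, (z i).1
      have h4 : a + b + e - (s + (n : ℝ) • (z N).1) =
          (a - a') + (a' - (n : ℝ) • (z N).1) + b + (e - s) := by abel
      rw [h4]
      refine (norm_add₄_le).trans ?_
      push_cast
      linarith

end Gluing

/-! ### Propagation of lower bounds to all large times -/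

section Propagation

variable {A E : Type*} [NormedAddCommGroup E] [InnerProductSpace ℝ E]

/-- A sequence with values in `{w₁, w₂}` whose partial sums stay within `‖w₁ - w₂‖` of those of
the constant sequence `l • w₁ + (1 - l) • w₂`. -/
lemma exists_interpolating_sequence {F : Type*} [NormedAddCommGroup F] [NormedSpace ℝ F]
    (w₁ w₂ : F) {l : ℝ} (hl0 : 0 ≤ l) (hl1 : l ≤ 1) :
    ∃ y : ℕ → F, (∀ i, y i = w₁ ∨ y i = w₂) ∧
      ∀ N : ℕ, ‖∑ i ∈ Finset.range N, y i - (N : ℝ) • (l • w₁ + (1 - l) • w₂)‖ ≤ ‖w₁ - w₂‖ := by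
  have hfloor : ∀ i : ℕ, ⌊(i + 1 : ℕ) * l⌋₊ = ⌊i * l⌋₊ ∨ ⌊(i + 1 : ℕ) * l⌋₊ = ⌊i * l⌋₊ + 1 := by
    intro i
    have h1 : ⌊i * l⌋₊ ≤ ⌊(i + 1 : ℕ) * l⌋₊ := Nat.floor_mono (by push_cast; nlinarith)
    have h2 : ⌊(i + 1 : ℕ) * l⌋₊ ≤ ⌊i * l + 1⌋₊ := Nat.floor_mono (by push_cast; nlinarith)
    rw [Nat.floor_add_one (by positivity)] at h2
    omega
  refine ⟨fun i => w₂ + ((⌊(i + 1 : ℕ) * l⌋₊ : ℝ) - ⌊i * l⌋₊) • (w₁ - w₂), fun i => ?_,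
    fun N => ?_⟩
  · rcases hfloor i with h | h
    · right; simp only [h, sub_self, zero_smul, add_zero]
    · left; simp only [h]; push_cast; simp
  · rw [Finset.sum_add_distrib, ← Finset.sum_smul,
      Finset.sum_range_sub (fun i : ℕ => ((⌊i * l⌋₊ : ℕ) : ℝ))]
    have h1 : ∑ i ∈ Finset.range N, w₂ + (((⌊N * l⌋₊ : ℕ) : ℝ) - ((⌊(0 : ℕ) * l⌋₊ : ℕ) : ℝ)) •
        (w₁ - w₂) - (N : ℝ) • (l • w₁ + (1 - l) • w₂) =
        ((⌊N * l⌋₊ : ℝ) - N * l) • (w₁ - w₂) := by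
      rw [Finset.sum_const, Finset.card_range, ← Nat.cast_smul_eq_nsmul ℝ]
      simp only [Nat.cast_zero, zero_mul, Nat.floor_zero, sub_zero]
      module
    rw [h1, norm_smul]
    refine mul_le_of_le_one_left (norm_nonneg _) ?_
    have h2 := Nat.floor_le (a := N * l) (by positivity)
    have h3 := Nat.lt_floor_add_one (N * l)
    rw [Real.norm_eq_abs, abs_le]
    constructor <;> linarith

variable [Finite A] [MeasurableSpace A] [MeasurableSingletonClass A]

/-- Lower bounds at a single time `n` propagate to all large times `t`, and to convex
combinations: `t / n` blocks of length `n` are concatenated, and the remainder is negligible. -/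
lemma DecoupledAt.eventually_expLowerBound {P : Measure (ℕ → A)} [IsProbabilityMeasure P]
    {n τ : ℕ} {c ε R : ℝ} (h : DecoupledAt P n τ c) (hn : 1 ≤ n) (hε : 0 < ε)
    (hcτ : c + τ ≤ ε * n) (hτ : τ * R ≤ ε * n)
    {f : (ℕ → A) → E} (hR : ∀ ω, ‖f ω‖ ≤ R)
    (hr : ∀ ω ω' : ℕ → A, (∀ i < n, ω i = ω' i) →
      ‖birkhoffSum shift f n ω - birkhoffSum shift f n ω'‖ ≤ ε * n)
    {w₁ w₂ : E × ℝ} (h₁ : ExpLowerBound P (birkhoffSum shift f) w₁ ε n)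
    (h₂ : ExpLowerBound P (birkhoffSum shift f) w₂ ε n) {l : ℝ} (hl0 : 0 ≤ l) (hl1 : l ≤ 1) :
    ∀ᶠ t : ℕ in atTop,
      ExpLowerBound P (birkhoffSum shift f) (l • w₁ + (1 - l) • w₂) (5 * ε) t := by
  obtain ⟨y, hy, hysum⟩ := exists_interpolating_sequence w₁ w₂ hl0 hl1
  set w := l • w₁ + (1 - l) • w₂
  set D := ‖w₁ - w₂‖
  have hD : 0 ≤ D := norm_nonneg _
  have hδ : Real.exp (-(n * ε)) ≤ Real.exp (-c) / (τ + 1) := by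
    rw [le_div_iff₀ (by positivity)]
    calc Real.exp (-(n * ε)) * (τ + 1) ≤ Real.exp (-(n * ε)) * Real.exp τ := by
          gcongr; exact Real.add_one_le_exp _
      _ = Real.exp (-(n * ε) + τ) := (Real.exp_add _ _).symm
      _ ≤ Real.exp (-c) := Real.exp_le_exp.2 (by linarith)
  have hR0 : 0 ≤ R := by
    have hne : Nonempty (ℕ → A) := nonempty_of_isProbabilityMeasure P
    exact (norm_nonneg _).trans (hR hne.some)
  have hn0 : (1 : ℝ) ≤ n := by exact_mod_cast hn
  filter_upwards [tendsto_natCast_atTop_atTop.eventually_ge_atTop (n * (|w.2| + D) / ε),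
    tendsto_natCast_atTop_atTop.eventually_ge_atTop (n * (R + D + ‖w.1‖) / ε)] with t ht1 ht2
  rw [div_le_iff₀ hε] at ht1 ht2
  obtain ⟨M, m, B, -, -, hM1, hM2, hPB, hSB⟩ := h.exists_concatenation hδ hR hr
    (fun i => ((y i).1, (y i).2 + ε)) (fun i => by
      rcases hy i with hi | hi <;> rw [hi]
      exacts [h₁, h₂]) (t / n)
  set N := t / n
  have hNt : (N : ℝ) * n ≤ t := by exact_mod_cast Nat.div_mul_le_self t n
  have htN : (t : ℝ) ≤ N * n + n := by
    have := Nat.lt_div_mul_add hn (a := t)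
    exact_mod_cast this.le
  have hM1' : (N : ℝ) * n ≤ M := by exact_mod_cast hM1
  have hM2' : (M : ℝ) ≤ N * (n + τ) := by exact_mod_cast hM2
  have hN0 : (0 : ℝ) ≤ N := N.cast_nonneg
  have hτ0 : (0 : ℝ) ≤ τ := τ.cast_nonneg
  have hfst : ‖∑ i ∈ Finset.range N, (y i).1 - (N : ℝ) • w.1‖ ≤ D := by
    refine le_trans ?_ (hysum N)
    simpa [Prod.fst_sum] using norm_fst_le (∑ i ∈ Finset.range N, y i - (N : ℝ) • w)
  have hsnd : ∑ i ∈ Finset.range N, (y i).2 ≤ N * w.2 + D := by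
    have h1 := (norm_snd_le (∑ i ∈ Finset.range N, y i - (N : ℝ) • w)).trans (hysum N)
    rw [Prod.snd_sub, Prod.snd_sum, Prod.smul_snd, smul_eq_mul, Real.norm_eq_abs] at h1
    linarith [le_abs_self (∑ i ∈ Finset.range N, (y i).2 - N * w.2)]
  refine le_trans (Real.exp_le_exp.2 (neg_le_neg ?_))
    (hPB.trans (measureReal_mono fun ω hω => ?_))
  · dsimp only
    rw [Finset.sum_add_distrib, Finset.sum_add_distrib, Finset.sum_const, Finset.card_range,
      nsmul_eq_mul]
    have h1 := mul_le_mul_of_nonneg_left hsnd (zero_le_one.trans hn0)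
    have h2 : N * n * w.2 ≤ t * w.2 + n * |w.2| := by
      have h3 : |((t : ℝ) - N * n) * w.2| ≤ n * |w.2| := by
        rw [abs_mul]
        exact mul_le_mul_of_nonneg_right (abs_le.2 ⟨by linarith, by linarith⟩) (abs_nonneg _)
      linarith [neg_abs_le (((t : ℝ) - N * n) * w.2)]
    have h3 := mul_le_mul_of_nonneg_right hNt hε.le
    nlinarith
  · have h1 := hSB ω hω
    have h2 : ‖birkhoffSum shift f t ω - birkhoffSum shift f M ω‖ ≤ (n + N * τ) * R := by
      rcases le_total M t with hMt | hMt
      · refine (norm_birkhoffSum_sub_le hR hMt ω).trans (mul_le_mul_of_nonneg_right ?_ hR0)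
        nlinarith
      · rw [norm_sub_rev]
        refine (norm_birkhoffSum_sub_le hR hMt ω).trans (mul_le_mul_of_nonneg_right ?_ hR0)
        nlinarith
    have h3 : ‖(n : ℝ) • (∑ i ∈ Finset.range N, (y i).1 - (N : ℝ) • w.1)‖ ≤ n * D := by
      rw [norm_smul, Real.norm_of_nonneg (by linarith)]
      exact mul_le_mul_of_nonneg_left hfst (by linarith)
    have h4 : ‖((N : ℝ) * n - t) • w.1‖ ≤ n * ‖w.1‖ := by
      rw [norm_smul]
      exact mul_le_mul_of_nonneg_right (abs_le.2 ⟨by linarith, by linarith⟩) (norm_nonneg _)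
    change ‖birkhoffSum shift f t ω - (t : ℝ) • w.1‖ ≤ 5 * ε * t
    have h5 : birkhoffSum shift f t ω - (t : ℝ) • w.1 =
        (birkhoffSum shift f t ω - birkhoffSum shift f M ω) +
        (birkhoffSum shift f M ω - (n : ℝ) • ∑ i ∈ Finset.range N, (y i).1) +
        (n : ℝ) • (∑ i ∈ Finset.range N, (y i).1 - (N : ℝ) • w.1) +
        ((N : ℝ) * n - t) • w.1 := by module
    rw [h5]
    refine norm_add₄_le.trans ?_
    have h6 := mul_le_mul_of_nonneg_left hτ hN0
    have h7 := mul_le_mul_of_nonneg_left hNt hε.le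
    nlinarith

lemma SelectiveLowerDecoupling.eventually_propagation [TopologicalSpace A] [DiscreteTopology A]
    {P : Measure (ℕ → A)} [IsProbabilityMeasure P] (hP : SelectiveLowerDecoupling P)
    (f : C(ℕ → A, E)) {ε : ℝ} (hε : 0 < ε) :
    ∀ᶠ n : ℕ in atTop, ∀ w₁ w₂ : E × ℝ, ExpLowerBound P (birkhoffSum shift f) w₁ ε n →
      ExpLowerBound P (birkhoffSum shift f) w₂ ε n → ∀ l : ℝ, 0 ≤ l → l ≤ 1 →
      ∀ᶠ t : ℕ in atTop,
        ExpLowerBound P (birkhoffSum shift f) (l • w₁ + (1 - l) • w₂) (5 * ε) t := by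
  obtain ⟨τ, c, -, hc, hτ, h⟩ := hP
  have hcτ := (hc.add hτ).eventually_le_const (by simpa using hε)
  have hτf := (hτ.mul_const ‖f‖).eventually_le_const (by simpa using hε)
  filter_upwards [eventually_ge_atTop 1, hcτ, hτf, eventually_norm_birkhoffSum_sub_le f hε]
    with n hn h1 h2 h3 w₁ w₂ hw₁ hw₂ l hl0 hl1
  have hn' : (0 : ℝ) < n := by exact_mod_cast hn
  have hdec : DecoupledAt P n (τ n) (c n) := h n hn
  refine hdec.eventually_expLowerBound hn hε ?_ ?_ f.norm_coe_le_norm h3 hw₁ hw₂ hl0 hl1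
  · rwa [← add_div, div_le_iff₀ hn'] at h1
  · rwa [div_mul_eq_mul_div, div_le_iff₀ hn'] at h2

/-- The local lower bound holds for all large times as soon as it holds infinitely often. -/
lemma SelectiveLowerDecoupling.eventualDichotomy [TopologicalSpace A] [DiscreteTopology A]
    {P : Measure (ℕ → A)} [IsProbabilityMeasure P] (hP : SelectiveLowerDecoupling P)
    (f : C(ℕ → A, E)) : EventualDichotomy P (birkhoffSum shift f) := by
  intro z hz
  have hz' : ∃ ε > 0, ¬ ∀ᶠ t : ℕ in atTop, ExpLowerBound P (birkhoffSum shift f) z ε t := by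
    by_contra! hcon
    exact hz hcon
  obtain ⟨ε, hε, hnot⟩ := hz'
  refine ⟨ε / 5, by positivity, ?_⟩
  by_contra hfreq
  rw [← Filter.Frequently] at hfreq
  obtain ⟨n, hn, hprop⟩ :=
    (hfreq.and_eventually (hP.eventually_propagation f (ε := ε / 5) (by positivity))).exists
  refine hnot ?_
  have h1 := hprop z z hn hn 1 zero_le_one le_rfl
  rw [mul_div_cancel₀ ε (by norm_num : (5 : ℝ) ≠ 0)] at h1
  simpa using h1

lemma SelectiveLowerDecoupling.convex_asymptoticEpigraph [TopologicalSpace A]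
    [DiscreteTopology A] {P : Measure (ℕ → A)} [IsProbabilityMeasure P]
    (hP : SelectiveLowerDecoupling P) (f : C(ℕ → A, E)) :
    Convex ℝ (asymptoticEpigraph P (birkhoffSum shift f)) := by
  intro w₁ hw₁ w₂ hw₂ a b ha hb hab ε hε
  have hε5 : 0 < ε / 5 := by positivity
  obtain ⟨n, hn₁, hn₂, hprop⟩ := ((hw₁ _ hε5).and ((hw₂ _ hε5).and
    (hP.eventually_propagation f hε5))).exists
  have h1 := hprop w₁ w₂ hn₁ hn₂ a ha (by linarith)
  rwa [mul_div_cancel₀ ε (by norm_num : (5 : ℝ) ≠ 0), ← eq_sub_of_add_eq' hab] at h1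

end Propagation

end ShiftLDP

theorem theorem2p1 {A : Type*} [Finite A] [TopologicalSpace A] [DiscreteTopology A]
    [MeasurableSpace A] [BorelSpace A]
    (P : MeasureTheory.Measure (ℕ → A)) [MeasureTheory.IsProbabilityMeasure P]
    (hinv : MeasureTheory.MeasurePreserving ShiftLDP.shift P P)
    (hSLD : ShiftLDP.SelectiveLowerDecoupling P)
    (d : ℕ) (f : C(ℕ → A, EuclideanSpace ℝ (Fin d))) :
    ∃ q : EuclideanSpace ℝ (Fin d) → ℝ,
      (∀ α : EuclideanSpace ℝ (Fin d),
        Filter.Tendsto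
          (fun t : ℕ => (1 / (t : ℝ)) *
            Real.log (∫ ω, Real.exp (inner ℝ α (birkhoffSum ShiftLDP.shift f t ω)) ∂P))
          Filter.atTop (nhds (q α))) ∧
      ConvexOn ℝ Set.univ q ∧
      LipschitzWith ‖f‖₊ q ∧
      ∃ I : EuclideanSpace ℝ (Fin d) → EReal,
        ShiftLDP.IsGoodRateFunction I ∧
        ShiftLDP.IsConvexFunction I ∧
        ShiftLDP.SatisfiesLDP P (fun t ω => birkhoffAverage ℝ ShiftLDP.shift f t ω) I ∧
        ∀ x, I x = ShiftLDP.legendreTransform q x := by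
  have hS : ∀ t ω, ‖birkhoffSum ShiftLDP.shift f t ω‖ ≤ t * (‖f‖₊ : ℝ) :=
    ShiftLDP.norm_birkhoffSum_le f.norm_coe_le_norm
  have hSm : ∀ t, Measurable (birkhoffSum ShiftLDP.shift f t) := fun t =>
    Finset.measurable_sum _ fun k _ =>
      f.continuous.measurable.comp (hinv.measurable.iterate k)
  have hdich := hSLD.eventualDichotomy f
  have hconv := hSLD.convex_asymptoticEpigraph f
  have hne := ShiftLDP.asymptoticEpigraph_nonempty hSm hS hdich
  exact ⟨ShiftLDP.epigraphConjugate P (birkhoffSum ShiftLDP.shift f),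
    ShiftLDP.tendsto_log_integral_exp hSm hS hdich,
    ShiftLDP.convexOn_epigraphConjugate hS hne, ShiftLDP.lipschitzWith_epigraphConjugate hS hne,
    ShiftLDP.legendreTransform _, ShiftLDP.isGoodRateFunction_legendreTransform hS hne hconv,
    ShiftLDP.isConvexFunction_legendreTransform _,
    ShiftLDP.satisfiesLDP_legendreTransform hS hdich hne hconv, fun _ => rfl⟩
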